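/- For a sequence $X=(X_i)_{i\in\mathbb N}$ of real random variables on a probability space $(\Omega,\mathcal F,\mathbb P)$, its tail $\sigma$-field is $\mathcal T(X)=\bigcap_{n}\sigma(X_i : i\ge n)$, and $X$ is called tail trivial if $\mathbb P(E)\in\{0,1\}$ for every $E\in\mathcal T(X)$. The sequence $X$ is negatively associated (NA) if $\mathbb E[f(X)g(X)]\le \mathbb E[f(X)]\,\mathbb E[g(X)]$ for all measurable coordinatewise increasing functions $f,g:\mathbb R^{\mathbb N}\to\mathbb R$ that depend on disjoint sets of coordinates and for which $f(X)$, $g(X)$ and $f(X)g(X)$ are integrable. A Gaussian threshold process is a process of the form $X_i=1_{\{Z_i\ge a_i\}}$ $(i\in\mathbb N)$, where $(Z_i)_{i\in\mathbb N}$ is a Gaussian process (all finite-dimensional distributions are Gaussian, possibly degenerate) and $(a_i)_{i\in\mathbb N}$ is a sequence of real numbers. Theorem. (1) Let $Z=(Z_i)_{i\in\mathbb N}$ be a Gaussian process with $\mathrm{cov}(Z_i,Z_j)\le 0$ for all distinct $i,j\in\mathbb N$. Then $Z$ is tail trivial, and so is the threshold process $(1_{\{Z_i\ge a_i\}})_{i\in\mathbb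 N}$ for every sequence $(a_i)_{i\in\mathbb N}$ of real numbers. (2) Every negatively associated Gaussian threshold process is tail trivial. -/

import Mathlib

open MeasureTheory ProbabilityTheory

/-- The tail σ-field `⋂ₙ σ(X i : i ≥ n)` of a sequence of real random variables. -/
@[reducible] def tailField {Ω : Type*} (X : ℕ → Ω → ℝ) : MeasurableSpace Ω :=
  ⨅ n : ℕ, ⨆ i : ℕ, ⨆ _ : n ≤ i, MeasurableSpace.comap (X i) inferInstance

/-- Every event of the tail σ-field has probability zero or one. -/
def IsTailTrivial {Ω : Type*} [MeasurableSpace Ω] (X : ℕ → Ω → ℝ) (P : Measure Ω) : Prop :=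
  ∀ E : Set Ω, MeasurableSet[tailField X] E → P E = 0 ∨ P E = 1

/-- Negative association: `E[f g] ≤ E[f] E[g]` for all (measurable) coordinatewise increasing
functions `f`, `g` of the process that depend on disjoint sets of its components, whenever the
three expectations exist. -/
def IsNegativelyAssociated {Ω : Type*} [MeasurableSpace Ω]
    (X : ℕ → Ω → ℝ) (P : Measure Ω) : Prop :=
  ∀ (A B : Set ℕ) (f g : (ℕ → ℝ) → ℝ), Disjoint A B →
    Measurable f → Measurable g → Monotone f → Monotone g → DependsOn f A → DependsOn g B →
    Integrable (fun ω ↦ f (fun i ↦ X i ω)) P →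
    Integrable (fun ω ↦ g (fun i ↦ X i ω)) P →
    Integrable (fun ω ↦ f (fun i ↦ X i ω) * g (fun i ↦ X i ω)) P →
    ∫ ω, f (fun i ↦ X i ω) * g (fun i ↦ X i ω) ∂P ≤
      (∫ ω, f (fun i ↦ X i ω) ∂P) * ∫ ω, g (fun i ↦ X i ω) ∂P

/-- The process of indicators `1_{Z i ≥ a i}`. -/
noncomputable def thresholdProcess {Ω : Type*} (Z : ℕ → Ω → ℝ) (a : ℕ → ℝ) : ℕ → Ω → ℝ :=
  fun i ↦ {ω | a i ≤ Z i ω}.indicator (fun _ ↦ 1)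

/-- `X` is obtained by thresholding some Gaussian process of random variables. -/
def IsGaussianThresholdProcess {Ω : Type*} [MeasurableSpace Ω]
    (X : ℕ → Ω → ℝ) (P : Measure Ω) : Prop :=
  ∃ (Z : ℕ → Ω → ℝ) (a : ℕ → ℝ),
    (∀ i, Measurable (Z i)) ∧ IsGaussianProcess Z P ∧ X = thresholdProcess Z a

/-! In `L²` the centred variables have nonpositive pairwise inner products. Adding `J` unit vectors
taken from the cones over disjoint blocks of indices gives a vector of norm at most `√J`. By
Cauchy-Schwarz a fixed `x` therefore cannot have inner product at least `ε` with such vectors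
arbitrarily far out. Splitting coefficients into positive and negative parts passes from cones to
spans (`exists_abs_inner_le`), so `x` has small projections to all finite pieces of a far tail.

Gaussianity turns this into independence. A finite combination `X` minus its projection `Y` to `Z n,
..., Z (N-1)` is independent of these variables, and `Var Y` is small uniformly in `N`. Hence the
characteristic function of `X` factorizes over every tail event `E`
(`setIntegral_cexp_linearCombination_of_tail`). So `E` is independent of the whole process, and thus
of itself.

Thresholding only shrinks the tail field. For a negatively associated threshold process, a positive
covariance of `Z i` and `Z j` would make the two exceedances strictly positively correlated
(`measureReal_mul_lt_of_covariance_pos`), which is excluded. The first part then applies to `Z`. -/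

/-! ### Hilbert space geometry of vectors with nonpositive inner products. -/

section NonposInner

open scoped InnerProductSpace

variable {E : Type*} [NormedAddCommGroup E] [InnerProductSpace ℝ E] {v : ℕ → E}

/-- Conic combinations with disjoint supports of vectors with nonpositive pairwise inner
products have nonpositive inner product. -/
lemma inner_linearCombination_nonpos (hv : ∀ i j, i ≠ j → ⟪v i, v j⟫_ℝ ≤ 0)
    {d e : ℕ →₀ ℝ} (hd : 0 ≤ d) (he : 0 ≤ e) (h : ∀ i, d i = 0 ∨ e i = 0) :
    ⟪Finsupp.linearCombination ℝ v d, Finsupp.linearCombination ℝ v e⟫_ℝ ≤ 0 := by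
  rw [Finsupp.linearCombination_apply, Finsupp.linearCombination_apply, Finsupp.sum, Finsupp.sum,
    sum_inner]
  refine Finset.sum_nonpos fun i _ ↦ ?_
  rw [inner_sum]
  refine Finset.sum_nonpos fun j _ ↦ ?_
  rw [real_inner_smul_left, real_inner_smul_right]
  rcases eq_or_ne i j with rfl | hij
  · rcases h i with h | h <;> simp [h]
  · exact mul_nonpos_of_nonneg_of_nonpos (hd i)
      (mul_nonpos_of_nonneg_of_nonpos (he j) (hv i j hij))

/-- A fixed vector is asymptotically not positively correlated with the tail cones. -/
lemma exists_inner_le_of_nonneg (hv : ∀ i j, i ≠ j → ⟪v i, v j⟫_ℝ ≤ 0) (x : E) {ε : ℝ}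
    (hε : 0 < ε) : ∃ n, ∀ d : ℕ →₀ ℝ, 0 ≤ d → (∀ i < n, d i = 0) →
      ⟪x, Finsupp.linearCombination ℝ v d⟫_ℝ ≤ ε * ‖Finsupp.linearCombination ℝ v d‖ := by
  by_contra! hcon
  -- The vector is a sum of `J` normalized counterexamples with disjoint supports. The cross terms
  -- are nonpositive, so its squared norm grows at most linearly, while each summand adds at least
  -- `ε` to the inner product with `x`.
  have key : ∀ J : ℕ, ∃ d : ℕ →₀ ℝ, 0 ≤ d ∧ ‖Finsupp.linearCombination ℝ v d‖ ^ 2 ≤ J ∧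
      J * ε ≤ ⟪x, Finsupp.linearCombination ℝ v d⟫_ℝ := by
    intro J
    induction J with
    | zero => exact ⟨0, le_rfl, by simp, by simp⟩
    | succ J ih =>
      obtain ⟨d, hd, hn, hi⟩ := ih
      -- Starting strictly beyond the last index used by `d` keeps the supports disjoint.
      obtain ⟨e, he, hes, hlt⟩ := hcon (d.support.sup id + 1)
      have hdis : ∀ i, d i = 0 ∨ e i = 0 := by
        intro i
        by_cases hi : d i = 0
        · exact Or.inl hi
        · exact Or.inr (hes i (Nat.lt_succ_of_le
            (Finset.le_sup (f := id) (Finsupp.mem_support_iff.2 hi))))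
      set u := Finsupp.linearCombination ℝ v e with hu
      have hu0 : 0 < ‖u‖ := by
        rw [norm_pos_iff]
        intro h
        simp [h] at hlt
      have hle := inner_linearCombination_nonpos hv hd he hdis
      refine ⟨d + ‖u‖⁻¹ • e, add_nonneg hd (smul_nonneg (by positivity) he), ?_, ?_⟩
      · rw [map_add, map_smul, ← hu, norm_add_sq_real, real_inner_smul_right, norm_smul, norm_inv,
          norm_norm, inv_mul_cancel₀ hu0.ne']
        push_cast
        have : ‖u‖⁻¹ * ⟪Finsupp.linearCombination ℝ v d, u⟫_ℝ ≤ 0 :=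
          mul_nonpos_of_nonneg_of_nonpos (by positivity) hle
        linarith
      · rw [map_add, map_smul, ← hu, inner_add_right, real_inner_smul_right]
        have : ε ≤ ‖u‖⁻¹ * ⟪x, u⟫_ℝ := by
          rw [inv_mul_eq_div, le_div_iff₀ hu0]
          exact hlt.le
        push_cast
        linarith
  obtain ⟨J, hJ⟩ := exists_nat_gt (‖x‖ ^ 2 / ε ^ 2)
  obtain ⟨d, -, hn, hi⟩ := key J
  have hJ0 : (0 : ℝ) < J := lt_of_le_of_lt (by positivity) hJ
  rw [div_lt_iff₀ (by positivity)] at hJ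
  have h1 : (J * ε) ^ 2 ≤ ‖x‖ ^ 2 * J :=
    calc (J * ε) ^ 2 ≤ (‖x‖ * ‖Finsupp.linearCombination ℝ v d‖) ^ 2 :=
          pow_le_pow_left₀ (by positivity) (hi.trans (real_inner_le_norm _ _)) 2
      _ = ‖x‖ ^ 2 * ‖Finsupp.linearCombination ℝ v d‖ ^ 2 := by ring
      _ ≤ ‖x‖ ^ 2 * J := by gcongr
  nlinarith

/-- A fixed vector is asymptotically orthogonal to the tail spans of a sequence of vectors with
nonpositive pairwise inner products. -/
lemma exists_abs_inner_le (hv : ∀ i j, i ≠ j → ⟪v i, v j⟫_ℝ ≤ 0) (x : E) {ε : ℝ}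
    (hε : 0 < ε) : ∃ n, ∀ d : ℕ →₀ ℝ, (∀ i < n, d i = 0) →
      |⟪x, Finsupp.linearCombination ℝ v d⟫_ℝ| ≤ ε * ‖Finsupp.linearCombination ℝ v d‖ := by
  obtain ⟨n₁, h₁⟩ := exists_inner_le_of_nonneg hv x (half_pos hε)
  obtain ⟨n₂, h₂⟩ := exists_inner_le_of_nonneg hv (-x) (half_pos hε)
  have hcone : ∀ d : ℕ →₀ ℝ, 0 ≤ d → (∀ i < max n₁ n₂, d i = 0) →
      |⟪x, Finsupp.linearCombination ℝ v d⟫_ℝ| ≤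
        ε / 2 * ‖Finsupp.linearCombination ℝ v d‖ := by
    intro d hd hs
    have a := h₁ d hd fun i hi ↦ hs i (lt_max_of_lt_left hi)
    have b := h₂ d hd fun i hi ↦ hs i (lt_max_of_lt_right hi)
    rw [inner_neg_left] at b
    exact abs_le.2 ⟨by linarith, a⟩
  refine ⟨max n₁ n₂, fun d hd ↦ ?_⟩
  have hp : ∀ i, (d⁺) i = max (d i) 0 := fun i ↦ rfl
  have hm : ∀ i, (d⁻) i = max (-d i) 0 := fun i ↦ rfl
  have hle := inner_linearCombination_nonpos hv (posPart_nonneg d) (negPart_nonneg d) (fun i ↦ by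
    rw [hp, hm]
    rcases le_total (d i) 0 with h | h
    · exact Or.inl (max_eq_right h)
    · exact Or.inr (max_eq_right (by linarith)))
  have ap := hcone d⁺ (posPart_nonneg d) fun i hi ↦ by rw [hp, hd i hi, max_self]
  have am := hcone d⁻ (negPart_nonneg d) fun i hi ↦ by rw [hm, hd i hi, neg_zero, max_self]
  have hsplit : Finsupp.linearCombination ℝ v d =
      Finsupp.linearCombination ℝ v d⁺ - Finsupp.linearCombination ℝ v d⁻ := by
    rw [← map_sub, posPart_sub_negPart]
  set p := Finsupp.linearCombination ℝ v d⁺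
  set q := Finsupp.linearCombination ℝ v d⁻
  rw [hsplit]
  have hn := norm_sub_sq_real p q
  -- Since `⟪p, q⟫ ≤ 0`, there is no cancellation: `‖p - q‖² ≥ ‖p‖² + ‖q‖²`.
  have hpn : ‖p‖ ≤ ‖p - q‖ := by
    refine le_of_sq_le_sq ?_ (norm_nonneg _)
    nlinarith [sq_nonneg ‖q‖]
  have hqn : ‖q‖ ≤ ‖p - q‖ := by
    refine le_of_sq_le_sq ?_ (norm_nonneg _)
    nlinarith [sq_nonneg ‖p‖]
  rw [inner_sub_right]
  calc |⟪x, p⟫_ℝ - ⟪x, q⟫_ℝ| ≤ |⟪x, p⟫_ℝ| + |⟪x, q⟫_ℝ| := abs_sub _ _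
    _ ≤ ε / 2 * ‖p - q‖ + ε / 2 * ‖p - q‖ := by
        refine add_le_add (ap.trans ?_) (am.trans ?_) <;> gcongr
    _ = ε * ‖p - q‖ := by ring

/-- The orthogonal projection of a vector to the span of finitely many others. -/
lemma exists_linearCombination_inner_sub_eq_zero (v : ℕ → E) (x : E) (s : Finset ℕ) :
    ∃ d : ℕ →₀ ℝ, (∀ i ∉ s, d i = 0) ∧
      ∀ i ∈ s, ⟪x - Finsupp.linearCombination ℝ v d, v i⟫_ℝ = 0 := by
  have : FiniteDimensional ℝ (Submodule.span ℝ (v '' s)) :=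
    FiniteDimensional.span_of_finite ℝ (s.finite_toSet.image v)
  obtain ⟨d, hd, hdx⟩ := (Finsupp.mem_span_image_iff_linearCombination ℝ).1
    ((Submodule.span ℝ (v '' s)).starProjection_apply_mem x)
  refine ⟨d, fun i hi ↦ Finsupp.notMem_support_iff.1 fun h ↦ hi (hd h), fun i hi ↦ ?_⟩
  rw [hdx]
  exact Submodule.starProjection_inner_eq_zero _ _ (Submodule.subset_span ⟨i, hi, rfl⟩)

/-- Orthogonal projections to finite pieces of the tail spans of a sequence of vectors with
nonpositive pairwise inner products are uniformly small. -/
lemma exists_forall_small_projection (hv : ∀ i j, i ≠ j → ⟪v i, v j⟫_ℝ ≤ 0) (x : E) {ε : ℝ}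
    (hε : 0 < ε) : ∃ n, ∀ s : Finset ℕ, (∀ i ∈ s, n ≤ i) →
      ∃ d : ℕ →₀ ℝ, ‖Finsupp.linearCombination ℝ v d‖ ≤ ε ∧
        ∀ i ∈ s, ⟪x - Finsupp.linearCombination ℝ v d, v i⟫_ℝ = 0 := by
  obtain ⟨n, hn⟩ := exists_abs_inner_le hv x hε
  refine ⟨n, fun s hs ↦ ?_⟩
  obtain ⟨d, hd, hx⟩ := exists_linearCombination_inner_sub_eq_zero v x s
  refine ⟨d, ?_, hx⟩
  have h0 : ⟪x - Finsupp.linearCombination ℝ v d, Finsupp.linearCombination ℝ v d⟫_ℝ = 0 := by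
    generalize x - Finsupp.linearCombination ℝ v d = y at hx
    rw [Finsupp.linearCombination_apply, Finsupp.sum, inner_sum]
    refine Finset.sum_eq_zero fun i hi ↦ ?_
    rw [real_inner_smul_right, hx i (by_contra fun h ↦ Finsupp.mem_support_iff.1 hi (hd i h)),
      mul_zero]
  have h1 := hn d fun i hi ↦ hd i fun h ↦ absurd (hs i h) (not_le.2 hi)
  -- For the projection `y` this reads `⟪x, y⟫ = ‖y‖²`, and the bound `⟪x, y⟫ ≤ ε * ‖y‖` then forces
  -- `‖y‖ ≤ ε`.
  rw [inner_sub_left, sub_eq_zero, real_inner_self_eq_norm_sq] at h0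
  have h2 := (le_abs_self _).trans h1
  rw [h0] at h2
  by_contra! h
  nlinarith

end NonposInner

/-! ### From small projections to independence and tail triviality. -/

section GaussianProcess

variable {Ω : Type*} [mΩ : MeasurableSpace Ω] {P : Measure Ω} {Z : ℕ → Ω → ℝ}

omit mΩ in
lemma linearCombination_apply_apply (c : ℕ →₀ ℝ) (ω : Ω) :
    Finsupp.linearCombination ℝ Z c ω = ∑ i ∈ c.support, c i * Z i ω := by
  simp [Finsupp.linearCombination_apply, Finsupp.sum, Finset.sum_apply]

lemma measurable_linearCombination (hZ : ∀ i, Measurable (Z i)) (c : ℕ →₀ ℝ) :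
    Measurable (Finsupp.linearCombination ℝ Z c) := by
  have : Finsupp.linearCombination ℝ Z c = fun ω ↦ ∑ i ∈ c.support, c i * Z i ω :=
    funext (linearCombination_apply_apply c)
  rw [this]
  fun_prop

lemma memLp_linearCombination {p : ENNReal} (hZ : ∀ i, MemLp (Z i) p P) (c : ℕ →₀ ℝ) :
    MemLp (Finsupp.linearCombination ℝ Z c) p P := by
  rw [Finsupp.linearCombination_apply, Finsupp.sum]
  exact memLp_finsetSum' _ fun i _ ↦ (hZ i).const_smul _

/-- The centred version of a square integrable process, as a sequence in `L²`. -/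
noncomputable def centeredLp [IsFiniteMeasure P] (hZ : ∀ i, MemLp (Z i) 2 P) (i : ℕ) : Lp ℝ 2 P :=
  ((hZ i).sub (memLp_const (∫ ω, Z i ω ∂P))).toLp

/-- This is the bridge from the covariance hypothesis to the geometric lemmas. -/
lemma inner_centeredLp [IsFiniteMeasure P] (hZ : ∀ i, MemLp (Z i) 2 P) (i j : ℕ) :
    inner ℝ (centeredLp hZ i) (centeredLp hZ j) = cov[Z i, Z j; P] := by
  rw [L2.inner_def, covariance]
  refine integral_congr_ae ?_
  filter_upwards [((hZ i).sub (memLp_const (∫ ω, Z i ω ∂P))).coeFn_toLp,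
    ((hZ j).sub (memLp_const (∫ ω, Z j ω ∂P))).coeFn_toLp] with ω hi hj
  simp only [centeredLp, hi, hj, Pi.sub_apply]
  simp [mul_comm]

lemma inner_linearCombination_centeredLp [IsFiniteMeasure P] (hZ : ∀ i, MemLp (Z i) 2 P)
    (c d : ℕ →₀ ℝ) :
    inner ℝ (Finsupp.linearCombination ℝ (centeredLp hZ) c)
      (Finsupp.linearCombination ℝ (centeredLp hZ) d) =
      cov[Finsupp.linearCombination ℝ Z c, Finsupp.linearCombination ℝ Z d; P] := by
  simp only [Finsupp.linearCombination_apply, Finsupp.sum]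
  rw [covariance_sum_sum' (fun i _ ↦ (hZ i).const_smul _) (fun i _ ↦ (hZ i).const_smul _),
    sum_inner]
  refine Finset.sum_congr rfl fun i _ ↦ ?_
  rw [inner_sum]
  refine Finset.sum_congr rfl fun j _ ↦ ?_
  rw [real_inner_smul_left, real_inner_smul_right, inner_centeredLp, covariance_smul_left,
    covariance_smul_right]

omit mΩ in
lemma iSup_comap_eq_comap_pi (s : Finset ℕ) :
    (⨆ i : s, MeasurableSpace.comap (Z i) inferInstance) =
      MeasurableSpace.comap (fun ω (i : s) ↦ Z i ω) inferInstance := by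
  simp [MeasurableSpace.pi, MeasurableSpace.comap_iSup, MeasurableSpace.comap_comp,
    Function.comp_def]

/-- A linear combination of a Gaussian process which is uncorrelated with finitely many of its
components is independent of them. -/
lemma indep_comap_linearCombination (hZm : ∀ i, Measurable (Z i)) (hZ : IsGaussianProcess Z P)
    (s : Finset ℕ) (c : ℕ →₀ ℝ)
    (h : ∀ i ∈ s, cov[Finsupp.linearCombination ℝ Z c, Z i; P] = 0) :
    Indep (⨆ i : s, MeasurableSpace.comap (Z i) inferInstance)
      (MeasurableSpace.comap (Finsupp.linearCombination ℝ Z c) inferInstance) P := by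
  have hG : IsGaussianProcess (Sum.elim (fun i : s ↦ Z i)
      (fun _ : Unit ↦ Finsupp.linearCombination ℝ Z c)) P := by
    refine hZ.of_isGaussianProcess ?_
    rintro (i | _)
    · exact ⟨{i.1}, ContinuousLinearMap.proj ⟨i.1, by simp⟩, fun ω ↦ by simp⟩
    · refine ⟨c.support, ∑ i : c.support, c i • ContinuousLinearMap.proj i, fun ω ↦ ?_⟩
      rw [Sum.elim_inr, linearCombination_apply_apply, ← Finset.sum_coe_sort]
      simp
  have hI := hG.indepFun_of_covariance_eq_zero (fun i ↦ (hZm i).aemeasurable)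
    (fun _ ↦ (measurable_linearCombination hZm c).aemeasurable)
    (fun i _ ↦ by rw [covariance_comm]; exact h i i.2)
  rw [iSup_comap_eq_comap_pi]
  exact (IndepFun_iff_Indep _ _ _).1 (hI.comp measurable_id (measurable_pi_apply ()))

/-- Jensen's inequality, obtained from nonnegativity of the variance of `|Y - E Y|`. -/
lemma integral_abs_sub_le_sqrt_variance [IsProbabilityMeasure P] {Y : Ω → ℝ} (hY : MemLp Y 2 P) :
    ∫ ω, |Y ω - ∫ ω', Y ω' ∂P| ∂P ≤ √(Var[Y; P]) := by
  have hc : MemLp (fun ω ↦ |Y ω - ∫ ω', Y ω' ∂P|) 2 P := (hY.sub (memLp_const _)).norm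
  refine Real.le_sqrt_of_sq_le ?_
  have h0 := variance_nonneg (fun ω ↦ |Y ω - ∫ ω', Y ω' ∂P|) P
  rw [variance_eq_sub hc] at h0
  rw [variance_eq_integral hY.aemeasurable]
  simpa using h0

lemma norm_cexp_mul_I_sub_le (x y : ℝ) :
    ‖Complex.exp (x * Complex.I) - Complex.exp (y * Complex.I)‖ ≤ |x - y| := by
  have : Complex.exp (x * Complex.I) - Complex.exp (y * Complex.I) =
      Complex.exp (y * Complex.I) * (Complex.exp (Complex.I * ((x - y : ℝ) : ℂ)) - 1) := by
    rw [mul_sub, ← Complex.exp_add, mul_one]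
    congr 2
    push_cast
    ring
  rw [this, norm_mul, Complex.norm_exp_ofReal_mul_I, one_mul]
  exact Real.norm_exp_I_mul_ofReal_sub_one_le

lemma integrable_cexp_mul_I [IsFiniteMeasure P] {X : Ω → ℝ} (hX : Measurable X) :
    Integrable (fun ω ↦ Complex.exp (X ω * Complex.I)) P := by
  refine Integrable.of_bound (C := 1) (by fun_prop) (ae_of_all _ fun ω ↦ ?_)
  rw [Complex.norm_exp_ofReal_mul_I]

lemma norm_setIntegral_cexp_sub_le [IsProbabilityMeasure P] {X Y : Ω → ℝ} (hX : Measurable X)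
    (hY : Measurable Y) (hXY : Integrable (fun ω ↦ X ω - Y ω) P) (A : Set Ω) :
    ‖∫ ω in A, Complex.exp (X ω * Complex.I) ∂P - ∫ ω in A, Complex.exp (Y ω * Complex.I) ∂P‖ ≤
      ∫ ω, |X ω - Y ω| ∂P := by
  rw [← integral_sub (integrable_cexp_mul_I hX) (integrable_cexp_mul_I hY)]
  refine (norm_integral_le_integral_norm _).trans ?_
  calc ∫ ω in A, ‖Complex.exp (X ω * Complex.I) - Complex.exp (Y ω * Complex.I)‖ ∂P
      ≤ ∫ ω in A, |X ω - Y ω| ∂P := by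
        refine integral_mono ?_ hXY.abs.integrableOn fun ω ↦ norm_cexp_mul_I_sub_le _ _
        exact ((integrable_cexp_mul_I hX).sub (integrable_cexp_mul_I hY)).norm
    _ ≤ ∫ ω, |X ω - Y ω| ∂P :=
        setIntegral_le_integral hXY.abs (ae_of_all _ fun _ ↦ abs_nonneg _)

/-- If `X - Y` is independent of an event, then the characteristic function of `X` approximately
factorizes over that event, up to twice the standard deviation of `Y`. -/
lemma norm_setIntegral_cexp_sub_smul_le [IsProbabilityMeasure P] {X Y : Ω → ℝ}
    (hX : Measurable X) (hYm : Measurable Y) (hY : MemLp Y 2 P) {A : Set Ω}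
    (hA : MeasurableSet A) (hI : Indep (MeasurableSpace.generateFrom {A})
      (MeasurableSpace.comap (X - Y) inferInstance) P) :
    ‖∫ ω in A, Complex.exp (X ω * Complex.I) ∂P -
      P.real A • ∫ ω, Complex.exp (X ω * Complex.I) ∂P‖ ≤ 2 * √(Var[Y; P]) := by
  -- Adding the mean back makes `X - W` centred while `W` stays independent of `A`. Replacing `X` by
  -- `W` costs one standard deviation on `A` and one on the whole space.
  set W : Ω → ℝ := fun ω ↦ X ω - Y ω + ∫ ω', Y ω' ∂P with hW
  have hWm : Measurable W := by fun_prop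
  have hdiff : ∀ ω, X ω - W ω = Y ω - ∫ ω', Y ω' ∂P := fun ω ↦ by rw [hW]; ring
  have hfac : ∫ ω in A, Complex.exp (W ω * Complex.I) ∂P =
      P.real A • ∫ ω, Complex.exp (W ω * Complex.I) ∂P :=
    hI.setIntegral_eq_smul (f := fun x : ℝ ↦ Complex.exp ((x + ∫ ω', Y ω' ∂P : ℝ) * Complex.I))
      (MeasurableSpace.generateFrom_singleton_le hA) (hX.sub hYm).aemeasurable
      (MeasurableSpace.measurableSet_generateFrom rfl) (by fun_prop)
  have hint : Integrable (fun ω ↦ X ω - W ω) P := by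
    simp_rw [hdiff]
    exact (hY.integrable one_le_two).sub (integrable_const _)
  have hE : ∫ ω, |X ω - W ω| ∂P ≤ √(Var[Y; P]) := by
    simp_rw [hdiff]
    exact integral_abs_sub_le_sqrt_variance hY
  have h1 := (norm_setIntegral_cexp_sub_le hX hWm hint A).trans hE
  have h2 := (norm_setIntegral_cexp_sub_le hX hWm hint Set.univ).trans hE
  rw [setIntegral_univ, setIntegral_univ] at h2
  have h3 : ‖P.real A • ∫ ω, Complex.exp (W ω * Complex.I) ∂P -
      P.real A • ∫ ω, Complex.exp (X ω * Complex.I) ∂P‖ ≤ √(Var[Y; P]) := by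
    rw [← smul_sub, norm_smul, norm_sub_rev, Real.norm_of_nonneg measureReal_nonneg]
    exact (mul_le_of_le_one_left (norm_nonneg _) measureReal_le_one).trans h2
  rw [hfac] at h1
  calc _ ≤ _ := norm_sub_le_norm_sub_add_norm_sub _
        (P.real A • ∫ ω, Complex.exp (W ω * Complex.I) ∂P) _
    _ ≤ 2 * √(Var[Y; P]) := by linarith

/-- An approximate factorization over the events of an increasing sequence of σ-fields extends to
the σ-field they generate. -/
lemma norm_setIntegral_sub_smul_le_of_iSup [IsProbabilityMeasure P] {m : ℕ → MeasurableSpace Ω}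
    (hmono : Monotone m) (hm : ∀ n, m n ≤ mΩ) {f : Ω → ℂ} (hf : Integrable f P)
    (hf1 : ∀ ω, ‖f ω‖ ≤ 1) {C : ℝ}
    (h : ∀ n A, MeasurableSet[m n] A → ‖∫ ω in A, f ω ∂P - P.real A • ∫ ω, f ω ∂P‖ ≤ C)
    {A : Set Ω} (hA : MeasurableSet[⨆ n, m n] A) :
    ‖∫ ω in A, f ω ∂P - P.real A • ∫ ω, f ω ∂P‖ ≤ C := by
  have hle : ⨆ n, m n ≤ mΩ := iSup_le hm
  have halg : IsSetAlgebra (⋃ n, {t | MeasurableSet[m n] t}) := by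
    refine ⟨Set.mem_iUnion.2 ⟨0, @MeasurableSet.empty _ (m 0)⟩, fun s hs ↦ ?_, fun s t hs ht ↦ ?_⟩
    · obtain ⟨n, hn⟩ := Set.mem_iUnion.1 hs
      exact Set.mem_iUnion.2 ⟨n, MeasurableSet.compl hn⟩
    · obtain ⟨n, hn⟩ := Set.mem_iUnion.1 hs
      obtain ⟨k, hk⟩ := Set.mem_iUnion.1 ht
      exact Set.mem_iUnion.2 ⟨max n k, MeasurableSet.union (hmono (le_max_left n k) _ hn)
        (hmono (le_max_right n k) _ hk)⟩
  -- The union of the increasing σ-fields is only an algebra, but it approximates every event of the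
  -- generated σ-field in measure.
  have hdense := @Measure.MeasureDense.of_generateFrom_isSetAlgebra_finite Ω (⨆ n, m n)
    (P.trim hle) _ _ halg (MeasurableSpace.generateFrom_iUnion_measurableSet m).symm
  refine le_of_forall_pos_le_add fun ε hε ↦ ?_
  obtain ⟨B, hB, hAB⟩ := @Measure.MeasureDense.approx _ (_) _ _ hdense A hA
    (measure_ne_top _ _) (ε / 2) (half_pos hε)
  obtain ⟨n, hn⟩ := Set.mem_iUnion.1 hB
  have hBs : MeasurableSet[⨆ n, m n] B := le_iSup m n _ hn
  rw [trim_measurableSet_eq hle (MeasurableSet.symmDiff hA hBs)] at hAB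
  have hAm := hle _ hA
  have hBm := hle _ hBs
  have hd : P.real (symmDiff A B) ≤ ε / 2 := ENNReal.toReal_le_of_le_ofReal (half_pos hε).le hAB.le
  have h1 : ‖∫ ω in A, f ω ∂P - ∫ ω in B, f ω ∂P‖ ≤ ε / 2 := by
    rw [← integral_indicator hAm, ← integral_indicator hBm,
      ← integral_sub (hf.indicator hAm) (hf.indicator hBm)]
    calc _ ≤ ∫ ω, ‖A.indicator f ω - B.indicator f ω‖ ∂P := norm_integral_le_integral_norm _
      _ ≤ ∫ ω, (symmDiff A B).indicator 1 ω ∂P := by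
        refine integral_mono ((hf.indicator hAm).sub (hf.indicator hBm)).norm
          ((integrable_const 1).indicator (hAm.symmDiff hBm)) fun ω ↦ ?_
        by_cases ha : ω ∈ A <;> by_cases hb : ω ∈ B <;>
          simp [ha, hb, Set.indicator, Set.mem_symmDiff, hf1]
      _ = P.real (symmDiff A B) := integral_indicator_one (hAm.symmDiff hBm)
      _ ≤ ε / 2 := hd
  have h2 : ‖P.real B • ∫ ω, f ω ∂P - P.real A • ∫ ω, f ω ∂P‖ ≤ ε / 2 := by
    rw [← sub_smul, norm_smul]
    have hf' : ‖∫ ω, f ω ∂P‖ ≤ 1 := by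
      simpa using norm_integral_le_of_norm_le_const (μ := P) (ae_of_all _ hf1)
    refine (mul_le_of_le_one_right (norm_nonneg _) hf').trans ?_
    rw [norm_sub_rev, Real.norm_eq_abs]
    exact (abs_measureReal_sub_le_measureReal_symmDiff hAm.nullMeasurableSet
      hBm.nullMeasurableSet).trans hd
  have h3 := h n B hn
  calc _ ≤ ‖∫ ω in A, f ω ∂P - ∫ ω in B, f ω ∂P‖ +
        ‖∫ ω in B, f ω ∂P - P.real A • ∫ ω, f ω ∂P‖ := norm_sub_le_norm_sub_add_norm_sub _ _ _
    _ ≤ ‖∫ ω in A, f ω ∂P - ∫ ω in B, f ω ∂P‖ + (‖∫ ω in B, f ω ∂P - P.real B • ∫ ω, f ω ∂P‖ +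
        ‖P.real B • ∫ ω, f ω ∂P - P.real A • ∫ ω, f ω ∂P‖) := by
        gcongr
        exact norm_sub_le_norm_sub_add_norm_sub _ _ _
    _ ≤ C + ε := by linarith

/-- For a Gaussian process with nonpositive correlations, the characteristic function of a finite
linear combination factorizes over tail events. -/
lemma setIntegral_cexp_linearCombination_of_tail [IsProbabilityMeasure P]
    (hZm : ∀ i, Measurable (Z i)) (hZ : IsGaussianProcess Z P)
    (hcov : ∀ i j : ℕ, i ≠ j → cov[Z i, Z j; P] ≤ 0) (c : ℕ →₀ ℝ) {E : Set Ω}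
    (hE : MeasurableSet[tailField Z] E) :
    ∫ ω in E, Complex.exp (Finsupp.linearCombination ℝ Z c ω * Complex.I) ∂P =
      P.real E • ∫ ω, Complex.exp (Finsupp.linearCombination ℝ Z c ω * Complex.I) ∂P := by
  have hL : ∀ i, MemLp (Z i) 2 P := fun i ↦ (hZ.hasGaussianLaw_eval i).memLp_two
  have hcomb := measurable_linearCombination hZm
  rw [← sub_eq_zero, ← norm_le_zero_iff]
  refine le_of_forall_pos_le_add fun ε hε ↦ ?_
  rw [zero_add]
  obtain ⟨n, hn⟩ := exists_forall_small_projection (v := centeredLp hL)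
    (fun i j hij ↦ (inner_centeredLp hL i j).trans_le (hcov i j hij))
    (Finsupp.linearCombination ℝ (centeredLp hL) c) (half_pos hε)
  -- With `n` fixed, these σ-fields increase with `N` to `σ(Z i : i ≥ n)`, which contains the tail
  -- event.
  let m : ℕ → MeasurableSpace Ω := fun N ↦
    ⨆ i : Finset.Ico n N, MeasurableSpace.comap (Z i) inferInstance
  have hEn : MeasurableSet[⨆ N, m N] E := by
    refine (?_ : tailField Z ≤ ⨆ N, m N) _ hE
    refine (iInf_le _ n).trans (iSup₂_le fun i hi ↦ ?_)
    exact le_iSup_of_le (i + 1) (le_iSup_of_le ⟨i, by simp [hi]⟩ le_rfl)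
  refine norm_setIntegral_sub_smul_le_of_iSup (m := m) ?_ ?_ (integrable_cexp_mul_I (hcomb c))
    (fun ω ↦ (Complex.norm_exp_ofReal_mul_I _).le) ?_ hEn
  · intro N M hNM
    refine iSup_le fun i ↦ le_iSup_of_le ⟨i, ?_⟩ le_rfl
    have := Finset.mem_Ico.1 i.2
    exact Finset.mem_Ico.2 ⟨this.1, this.2.trans_le hNM⟩
  · exact fun N ↦ iSup_le fun i ↦ (hZm i).comap_le
  · intro N A hA
    -- The projection depends on `N`, but the bound on its norm does not.
    obtain ⟨d, hd, hdo⟩ := hn (Finset.Ico n N) fun i hi ↦ (Finset.mem_Ico.1 hi).1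
    have hI := indep_comap_linearCombination hZm hZ (Finset.Ico n N) (c - d) fun i hi ↦ by
      have := hdo i hi
      rwa [← map_sub, ← one_smul ℝ (centeredLp hL i), ← Finsupp.linearCombination_single,
        inner_linearCombination_centeredLp, Finsupp.linearCombination_single, one_smul] at this
    rw [map_sub] at hI
    have hv : √(Var[Finsupp.linearCombination ℝ Z d; P]) ≤ ε / 2 := by
      rwa [← covariance_self (hcomb d).aemeasurable, ← inner_linearCombination_centeredLp hL,
        real_inner_self_eq_norm_sq, Real.sqrt_sq (norm_nonneg _)]
    have := norm_setIntegral_cexp_sub_smul_le (hcomb c)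
      (hcomb d) (memLp_linearCombination hL d) ((iSup_le fun i ↦ (hZm i).comap_le : m N ≤ mΩ) _ hA)
      (indep_of_indep_of_le_left hI (MeasurableSpace.generateFrom_singleton_le hA))
    linarith

/-- A Gaussian process with nonpositive correlations is tail trivial. -/
theorem isTailTrivial_of_covariance_nonpos [IsProbabilityMeasure P]
    (hZm : ∀ i, Measurable (Z i)) (hZ : IsGaussianProcess Z P)
    (hcov : ∀ i j : ℕ, i ≠ j → cov[Z i, Z j; P] ≤ 0) : IsTailTrivial Z P := by
  intro E hE
  have hEZ : MeasurableSet[⨆ i, MeasurableSpace.comap (Z i) inferInstance] E := by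
    refine (?_ : tailField Z ≤ _) _ hE
    exact (iInf_le _ 0).trans (iSup₂_le fun i _ ↦ le_iSup_of_le i le_rfl)
  have hEm : MeasurableSet E := (iSup_le fun i ↦ (hZm i).comap_le) _ hEZ
  have hfin : ∀ s : Finset ℕ, Indep (⨆ i : s, MeasurableSpace.comap (Z i) inferInstance)
      (MeasurableSpace.generateFrom {E}) P := by
    intro s
    set W : Ω → s → ℝ := fun ω i ↦ Z i ω with hW
    have hWm : Measurable W := by fun_prop
    -- Uniqueness of characteristic functions: every linear functional of `W` is a finite
    -- combination of the process, for which factorization over `E` is known.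
    have hlaw : (P.restrict E).map W = P E • P.map W := by
      have : IsFiniteMeasure (P E • P.map W) := Measure.smul_finite _ (measure_ne_top _ _)
      refine Measure.ext_of_charFunDual (funext fun L ↦ ?_)
      rw [charFunDual_apply, charFunDual_apply, integral_smul_measure,
        integral_map hWm.aemeasurable (by fun_prop), integral_map hWm.aemeasurable (by fun_prop)]
      obtain ⟨c, hc⟩ : ∃ c : ℕ →₀ ℝ, ∀ ω, Finsupp.linearCombination ℝ Z c ω = L (W ω) := by
        refine ⟨∑ i : s, Finsupp.single i.1 (L fun j ↦ if i = j then 1 else 0), fun ω ↦ ?_⟩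
        rw [← L.coe_coe, LinearMap.pi_apply_eq_sum_univ]
        simp [Finsupp.linearCombination_single, hW, mul_comm]
      simp_rw [← hc]
      exact setIntegral_cexp_linearCombination_of_tail hZm hZ hcov c hE
    rw [iSup_comap_eq_comap_pi]
    refine IndepSets.indep hWm.comap_le (MeasurableSpace.generateFrom_le (by simpa using hEm))
      (@MeasurableSpace.isPiSystem_measurableSet _ (MeasurableSpace.comap W inferInstance))
      (IsPiSystem.singleton E) (@MeasurableSpace.generateFrom_measurableSet _
        (MeasurableSpace.comap W inferInstance)).symm rfl ?_
    rw [IndepSets_iff]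
    rintro A F ⟨B, hB, rfl⟩ rfl
    have := congrArg (fun μ ↦ μ B) hlaw
    rw [Measure.map_apply hWm hB, Measure.restrict_apply (hWm hB), Measure.smul_apply,
      Measure.map_apply hWm hB, smul_eq_mul, mul_comm] at this
    exact this
  have hall : Indep (⨆ s : Finset ℕ, ⨆ i : s, MeasurableSpace.comap (Z i) inferInstance)
      (MeasurableSpace.generateFrom {E}) P := by
    refine indep_iSup_of_monotone hfin (fun s ↦ iSup_le fun i ↦ (hZm i).comap_le)
      (MeasurableSpace.generateFrom_le (by simpa using hEm)) fun s t hst ↦ ?_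
    exact iSup_le fun i ↦ le_iSup_of_le ⟨i, hst i.2⟩ le_rfl
  -- As `E` itself belongs to the σ-field of the process, it is independent of itself.
  refine measure_eq_zero_or_one_of_indepSet_self
    (indep_of_indep_of_le_left hall (MeasurableSpace.generateFrom_le ?_))
  rintro _ rfl
  refine (iSup_le fun i ↦ ?_ : (⨆ i, MeasurableSpace.comap (Z i) inferInstance) ≤ _) _ hEZ
  exact le_iSup_of_le {i} (le_iSup_of_le ⟨i, by simp⟩ le_rfl)

omit mΩ in
lemma tailField_thresholdProcess_le (a : ℕ → ℝ) :
    tailField (thresholdProcess Z a) ≤ tailField Z := by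
  refine iInf_mono fun n ↦ iSup₂_mono fun i _ ↦ ?_
  have : Measurable[MeasurableSpace.comap (Z i) inferInstance] (thresholdProcess Z a i) :=
    Measurable.indicator (m := MeasurableSpace.comap (Z i) inferInstance) measurable_const
      ⟨Set.Ici (a i), measurableSet_Ici, rfl⟩
  exact this.comap_le

lemma isTailTrivial_thresholdProcess (h : IsTailTrivial Z P) (a : ℕ → ℝ) :
    IsTailTrivial (thresholdProcess Z a) P :=
  fun E hE ↦ h E (tailField_thresholdProcess_le a _ hE)

end GaussianProcess

/-! ### Exceedances of positively correlated Gaussian variables. -/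

section ThresholdCovariance

/-- Strict Chebyshev association inequality between a half-line and a nonconstant monotone
function, for a probability measure charging all half-lines. -/
lemma measureReal_Ici_mul_integral_lt_setIntegral {μ : Measure ℝ} [IsProbabilityMeasure μ]
    (hIci : ∀ x, 0 < μ.real (Set.Ici x)) (hIic : ∀ x, 0 < μ.real (Set.Iic x)) {g : ℝ → ℝ}
    (hg : Monotone g) (hgi : Integrable g μ) {x y : ℝ} (hxy : g x < g y) (a : ℝ) :
    μ.real (Set.Ici a) * ∫ u, g u ∂μ < ∫ u in Set.Ici a, g u ∂μ := by
  have hc : (Set.Ici a)ᶜ = Set.Iio a := Set.compl_Ici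
  have hq : 0 < μ.real (Set.Iio a) := (hIic (a - 1)).trans_le
    (measureReal_mono fun u hu ↦ lt_of_le_of_lt (Set.mem_Iic.1 hu) (sub_one_lt a))
  have hp := hIci a
  have hpq : μ.real (Set.Ici a) + μ.real (Set.Iio a) = 1 := by
    rw [← hc, measureReal_add_measureReal_compl measurableSet_Ici, probReal_univ]
  have hsum := integral_add_compl (measurableSet_Ici (a := a)) hgi
  rw [hc] at hsum
  have hupper : ∀ z ≥ a, (g z - g a) * μ.real (Set.Ici z) ≤
      ∫ u in Set.Ici a, g u ∂μ - g a * μ.real (Set.Ici a) := by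
    intro z hz
    have hi : Integrable (fun u ↦ g u - g a) μ := hgi.sub (integrable_const _)
    calc _ ≤ ∫ u in Set.Ici z, (g u - g a) ∂μ :=
          setIntegral_ge_of_const_le_real measurableSet_Ici (measure_ne_top _ _)
            (fun u hu ↦ sub_le_sub_right (hg hu) _) hi.integrableOn
      _ ≤ ∫ u in Set.Ici a, (g u - g a) ∂μ :=
          setIntegral_mono_set hi.integrableOn
            ((ae_restrict_iff' measurableSet_Ici).2 (ae_of_all _ fun u hu ↦ sub_nonneg.2 (hg hu)))
            (Set.Ici_subset_Ici.2 hz).eventuallyLE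
      _ = _ := by
          rw [integral_sub hgi.integrableOn (integrable_const _), setIntegral_const, smul_eq_mul,
            mul_comm]
  have hlower : ∀ z < a, (g a - g z) * μ.real (Set.Iic z) ≤
      g a * μ.real (Set.Iio a) - ∫ u in Set.Iio a, g u ∂μ := by
    intro z hz
    have hi : Integrable (fun u ↦ g a - g u) μ := (integrable_const _).sub hgi
    calc _ ≤ ∫ u in Set.Iic z, (g a - g u) ∂μ :=
          setIntegral_ge_of_const_le_real measurableSet_Iic (measure_ne_top _ _)
            (fun u hu ↦ sub_le_sub_left (hg hu) _) hi.integrableOn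
      _ ≤ ∫ u in Set.Iio a, (g a - g u) ∂μ :=
          setIntegral_mono_set hi.integrableOn
            ((ae_restrict_iff' measurableSet_Iio).2
              (ae_of_all _ fun u hu ↦ sub_nonneg.2 (hg (le_of_lt hu))))
            (Set.Iic_subset_Iio.2 hz).eventuallyLE
      _ = _ := by
          rw [integral_sub (integrable_const _) hgi.integrableOn, setIntegral_const, smul_eq_mul,
            mul_comm (g a)]
  have hu0 := hupper a le_rfl
  have hl0 : 0 ≤ g a * μ.real (Set.Iio a) - ∫ u in Set.Iio a, g u ∂μ :=
    le_trans (mul_nonneg (sub_nonneg.2 (hg (sub_one_lt a).le)) measureReal_nonneg)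
      (hlower (a - 1) (sub_one_lt a))
  rw [sub_self, zero_mul] at hu0
  set p := μ.real (Set.Ici a)
  set q := μ.real (Set.Iio a)
  set I := ∫ u in Set.Ici a, g u ∂μ
  set J := ∫ u in Set.Iio a, g u ∂μ
  -- Comparing `g` with its value at `a` splits the covariance into two nonnegative terms. The first
  -- is positive if `g` rises above `g a`, the second if it falls below; `g x < g y` guarantees one
  -- of these.
  have hid : I - p * ∫ u, g u ∂μ = q * (I - g a * p) + p * (g a * q - J) := by
    rw [← hsum]
    linear_combination (-I) * hpq
  rw [← sub_pos, hid]
  rcases lt_or_ge (g a) (g y) with h | h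
  · have hy : a ≤ y := (hg.reflect_lt h).le
    have := mul_pos (sub_pos.2 h) (hIci y)
    exact add_pos_of_pos_of_nonneg (mul_pos hq (this.trans_le (hupper y hy)))
      (mul_nonneg hp.le hl0)
  · have hx : g x < g a := hxy.trans_le h
    have := mul_pos (sub_pos.2 hx) (hIic x)
    exact add_pos_of_nonneg_of_pos (mul_nonneg hq.le hu0)
      (mul_pos hp (this.trans_le (hlower x (hg.reflect_lt hx))))

lemma measureReal_prod_inter_eq_setIntegral {μ ν : Measure ℝ} [IsProbabilityMeasure μ]
    [IsProbabilityMeasure ν] {s : Set ℝ} (hs : MeasurableSet s) {t : Set (ℝ × ℝ)}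
    (ht : MeasurableSet t) :
    (μ.prod ν).real (Prod.fst ⁻¹' s ∩ t) = ∫ u in s, ν.real (Prod.mk u ⁻¹' t) ∂μ := by
  have hm : Measurable fun u ↦ ν (Prod.mk u ⁻¹' t) := measurable_measure_prodMk_left ht
  simp only [measureReal_def]
  rw [integral_toReal hm.aemeasurable (ae_of_all _ fun _ ↦ measure_lt_top _ _),
    Measure.prod_apply ((measurable_fst hs).inter ht), ← lintegral_indicator hs]
  congr 2
  funext u
  by_cases hu : u ∈ s <;> simp [hu, Set.preimage_preimage]

/-- The mass of `Set.Ici` tends to `0` at `+∞` and to `1` at `-∞`. No nondegeneracy is needed, so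
this also covers a constant regression residual. -/
lemma exists_measureReal_Ici_lt (ν : Measure ℝ) [IsProbabilityMeasure ν] :
    ∃ s t, ν.real (Set.Ici s) < ν.real (Set.Ici t) := by
  obtain ⟨s, hs⟩ := ((tendsto_cdf_atTop ν).eventually_const_lt one_half_lt_one).exists
  obtain ⟨t, ht⟩ := ((tendsto_cdf_atBot ν).eventually_lt_const one_half_pos).exists
  rw [cdf_eq_real] at hs ht
  have hs' : ν.real (Set.Ici (s + 1)) ≤ 1 - ν.real (Set.Iic s) := by
    rw [← probReal_compl_eq_one_sub measurableSet_Iic, Set.compl_Iic]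
    exact measureReal_mono fun u hu ↦ (lt_add_one s).trans_le hu
  have ht' : 1 - ν.real (Set.Iic t) ≤ ν.real (Set.Ici t) := by
    rw [← probReal_compl_eq_one_sub measurableSet_Iic, Set.compl_Iic]
    exact measureReal_mono Set.Ioi_subset_Ici_self
  exact ⟨s + 1, t, by linarith⟩

lemma gaussianReal_real_pos {m : ℝ} {v : NNReal} (hv : v ≠ 0) {s : Set ℝ}
    (hs : volume s ≠ 0) : 0 < (gaussianReal m v).real s := by
  refine ENNReal.toReal_pos (fun h ↦ hs ?_) (measure_ne_top _ _)
  exact gaussianReal_absolutelyContinuous' m hv h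

variable {Ω : Type*} [MeasurableSpace Ω] {P : Measure Ω} [IsProbabilityMeasure P]

/-- Positively correlated jointly Gaussian variables have positively correlated exceedances. -/
lemma measureReal_mul_lt_of_covariance_pos {U V : Ω → ℝ} (hU : Measurable U) (hV : Measurable V)
    (hG : HasGaussianLaw (fun ω ↦ (U ω, V ω)) P) (hcov : 0 < cov[U, V; P]) (a b : ℝ) :
    P.real {ω | a ≤ U ω} * P.real {ω | b ≤ V ω} < P.real ({ω | a ≤ U ω} ∩ {ω | b ≤ V ω}) := by
  have hU2 := hG.fst.memLp_two
  have hV2 := hG.snd.memLp_two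
  -- An almost surely constant `U` would have zero covariance with `V`.
  have hvar : 0 < Var[U; P] := by
    refine (variance_nonneg U P).lt_of_ne fun h ↦ hcov.ne' ?_
    rw [covariance]
    refine integral_eq_zero_of_ae ?_
    filter_upwards [ae_eq_integral_of_variance_eq_zero hU2 h.symm] with ω hω
    simp [hω]
  -- The regression coefficient of `V` on `U`: it makes the residual `W` uncorrelated with `U`,
  -- hence independent. Given `U = u`, exceedance of `b` has probability `ν.real (Set.Ici (b - β *
  -- u))`, which increases in `u` because `β > 0`.
  set β := cov[U, V; P] / Var[U; P] with hβ
  have hβ0 : 0 < β := div_pos hcov hvar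
  set W : Ω → ℝ := fun ω ↦ V ω - β * U ω with hW
  have hWm : Measurable W := by fun_prop
  have hind : IndepFun U W P := by
    have hUW : HasGaussianLaw (fun ω ↦ (U ω, W ω)) P :=
      hG.map_fun ((ContinuousLinearMap.fst ℝ ℝ ℝ).prod
        (ContinuousLinearMap.snd ℝ ℝ ℝ - β • ContinuousLinearMap.fst ℝ ℝ ℝ))
    refine hUW.indepFun_of_covariance_eq_zero ?_
    rw [covariance_fun_sub_right hU2 hV2 (hU2.const_mul β), covariance_const_mul_right,
      covariance_self hU.aemeasurable, hβ, div_mul_cancel₀ _ hvar.ne', sub_self]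
  have hlaw := hind.map_prod_eq_prod_map_map hU.aemeasurable hWm.aemeasurable
  have := Measure.isProbabilityMeasure_map (μ := P) hU.aemeasurable
  have := Measure.isProbabilityMeasure_map (μ := P) hWm.aemeasurable
  set μ := P.map U with hμ
  set ν := P.map W with hν
  set t : Set (ℝ × ℝ) := {p | b ≤ p.2 + β * p.1} with ht
  have htm : MeasurableSet t := measurableSet_le measurable_const (by fun_prop)
  have hsec : ∀ u, Prod.mk u ⁻¹' t = Set.Ici (b - β * u) := fun u ↦ by
    ext w
    simp [ht]
  have hprob : ∀ s, MeasurableSet s → P.real (U ⁻¹' s ∩ {ω | b ≤ V ω}) =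
      ∫ u in s, ν.real (Set.Ici (b - β * u)) ∂μ := by
    intro s hs
    simp_rw [← hsec]
    rw [← measureReal_prod_inter_eq_setIntegral hs htm, ← hlaw,
      map_measureReal_apply (hU.prodMk hWm) ((measurable_fst hs).inter htm)]
    congr 1
    ext ω
    simp [ht, hW]
  have hmono : Monotone fun u ↦ ν.real (Set.Ici (b - β * u)) := fun u u' huu ↦
    measureReal_mono (Set.Ici_subset_Ici.2
      (sub_le_sub_left (mul_le_mul_of_nonneg_left huu hβ0.le) b))
  have hint : Integrable (fun u ↦ ν.real (Set.Ici (b - β * u))) μ := by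
    refine Integrable.of_bound hmono.measurable.aestronglyMeasurable 1 (ae_of_all _ fun u ↦ ?_)
    rw [Real.norm_of_nonneg measureReal_nonneg]
    exact measureReal_le_one
  obtain ⟨x, y, hxy⟩ := exists_measureReal_Ici_lt ν
  have hval : ∀ z, b - β * ((b - z) / β) = z := fun z ↦ by
    field_simp
    ring
  have hgauss : μ = gaussianReal P[U] Var[U; P].toNNReal := hG.fst.map_eq_gaussianReal
  have hv : Var[U; P].toNNReal ≠ 0 := by simpa using hvar
  have key := measureReal_Ici_mul_integral_lt_setIntegral (μ := μ)
    (fun x ↦ by rw [hgauss]; exact gaussianReal_real_pos hv (by simp))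
    (fun x ↦ by rw [hgauss]; exact gaussianReal_real_pos hv (by simp)) hmono hint
    (x := (b - x) / β) (y := (b - y) / β) (by simpa only [hval] using hxy) a
  have h1 := hprob Set.univ MeasurableSet.univ
  rw [Set.preimage_univ, Set.univ_inter, setIntegral_univ] at h1
  rw [← h1, ← hprob _ measurableSet_Ici, hμ, map_measureReal_apply hU measurableSet_Ici] at key
  exact key

/-- The components of a Gaussian process with negatively associated exceedances are nonpositively
correlated. -/
lemma covariance_nonpos_of_isNegativelyAssociated_thresholdProcess {Z : ℕ → Ω → ℝ} {a : ℕ → ℝ}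
    (hZm : ∀ i, Measurable (Z i)) (hZ : IsGaussianProcess Z P)
    (hNA : IsNegativelyAssociated (thresholdProcess Z a) P) {i j : ℕ} (hij : i ≠ j) :
    cov[Z i, Z j; P] ≤ 0 := by
  by_contra! hcov
  have hlt := measureReal_mul_lt_of_covariance_pos (hZm i) (hZm j) hZ.hasGaussianLaw_prodMk hcov
    (a i) (a j)
  have hms : ∀ k, MeasurableSet {ω | a k ≤ Z k ω} := fun k ↦
    measurableSet_le measurable_const (hZm k)
  have hX : ∀ k, Integrable (thresholdProcess Z a k) P := fun k ↦
    (integrable_const 1).indicator (hms k)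
  have hmul : (fun ω ↦ thresholdProcess Z a i ω * thresholdProcess Z a j ω) =
      ({ω | a i ≤ Z i ω} ∩ {ω | a j ≤ Z j ω}).indicator 1 := by
    funext ω
    simp only [thresholdProcess]
    rw [Set.inter_indicator_one]
    rfl
  -- Testing negative association on two coordinates suffices, since the threshold variables are
  -- themselves the exceedance indicators.
  have hmain := hNA {i} {j} (fun x ↦ x i) (fun x ↦ x j) (Set.disjoint_singleton.2 hij)
    (measurable_pi_apply i) (measurable_pi_apply j) (fun _ _ h ↦ h i) (fun _ _ h ↦ h j)
    (fun _ _ h ↦ h i rfl) (fun _ _ h ↦ h j rfl) (hX i) (hX j) (by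
      rw [hmul]
      exact (integrable_const 1).indicator ((hms i).inter (hms j)))
  have hval : ∀ k, ∫ ω, thresholdProcess Z a k ω ∂P = P.real {ω | a k ≤ Z k ω} := fun k ↦
    integral_indicator_one (hms k)
  rw [hmul, integral_indicator_one ((hms i).inter (hms j)), hval, hval] at hmain
  exact absurd hlt (not_lt.2 hmain)

end ThresholdCovariance

theorem mainTheorem3 {Ω : Type*} [MeasurableSpace Ω] (P : Measure Ω) [IsProbabilityMeasure P] :
    (∀ Z : ℕ → Ω → ℝ, (∀ i, Measurable (Z i)) → IsGaussianProcess Z P →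
      (∀ i j : ℕ, i ≠ j → cov[Z i, Z j; P] ≤ 0) →
        IsTailTrivial Z P ∧ ∀ a : ℕ → ℝ, IsTailTrivial (thresholdProcess Z a) P) ∧
    (∀ X : ℕ → Ω → ℝ, IsGaussianThresholdProcess X P → IsNegativelyAssociated X P →
      IsTailTrivial X P) := by
  refine ⟨fun Z hZm hZ hcov ↦ ?_, ?_⟩
  · have h := isTailTrivial_of_covariance_nonpos hZm hZ hcov
    exact ⟨h, isTailTrivial_thresholdProcess h⟩
  · rintro _ ⟨Z, a, hZm, hZ, rfl⟩ hNA
    refine isTailTrivial_thresholdProcess (isTailTrivial_of_covariance_nonpos hZm hZ fun i j hij ↦ ?_) a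
    exact covariance_nonpos_of_isNegativelyAssociated_thresholdProcess hZm hZ hNA hij
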